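/- All directed sets are nonempty partially ordered sets in which every finite subset has an upper bound. A directed set $P$ has calibre $(\omega_1,\omega)$ if each uncountable subset of $P$ contains an infinite subset that has an upper bound in $P$. $P$ is powerfully calibre $(\omega_1,\omega)$ if its countable power $P^\omega$ (coordinatewise order) has calibre $(\omega_1,\omega)$, and productively calibre $(\omega_1,\omega)$ if $P\times Q$ has calibre $(\omega_1,\omega)$ for every directed set $Q$ with calibre $(\omega_1,\omega)$. For a directed set $P$ with minimum element $0$, $\Sigma P^{\omega_1}$ denotes the set of all $p\in P^{\omega_1}$ with countable support $\{\alpha<\omega_1 : p_\alpha\neq 0\}$, with the product order. A set $A\subseteq\mathbb{R}$ is totally imperfect if it contains no nonempty perfect subset of $\mathbb{R}$. **Statement.** There exist totally imperfect sets of reals of size $\omega_1$. Let $A$ be any such set, indexed bijectively as $A=\{x_\alpha : \alpha<\omega_1\}$, let $X$ be the set $A$ with the coarsest topology that refines the one inherited from $\mathbb{R}$ and in which all the sets $U_\alpha=\{x_\beta : \beta\ge\alpha\}$, $\alpha<\omega_1$, are open, and let $P=\mathcal{K}(X)$ be the set of all compact subsets of $X$ (including $\emptyset$), ordered by inclusion.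 Then: (i) $P\times\Sigma\omega^{\omega_1}$ does not have calibre $(\omega_1,\omega)$, but each of its countable subproducts does; that is, $\omega^J$ and $P\times\omega^J$ have calibre $(\omega_1,\omega)$ for every countable $J\subseteq\omega_1$; (ii) $\Sigma P^{\omega_1}$ does not have calibre $(\omega_1,\omega)$, but $P^\omega$, and $P^J$ for every countable $J\subseteq\omega_1$, do. Hence both $P$ and $\Sigma\omega^{\omega_1}$ are powerfully calibre $(\omega_1,\omega)$ but not productively calibre $(\omega_1,\omega)$. -/

import Mathlib

open scoped Ordinal Cardinal

/-! ### Directed sets and calibre `(ω₁, ω)`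

A directed set is a nonempty partially ordered set `P` with `IsDirectedOrder P`. -/

/-- Finite products of directed sets, with the coordinatewise order, are directed. -/
instance Prod.instIsDirectedOrderOfFactors (P Q : Type*) [PartialOrder P] [IsDirectedOrder P]
    [PartialOrder Q] [IsDirectedOrder Q] : IsDirectedOrder (P × Q) := by
  refine ⟨fun x y => ?_⟩
  obtain ⟨a, ha, ha'⟩ := exists_ge_ge x.1 y.1
  obtain ⟨b, hb, hb'⟩ := exists_ge_ge x.2 y.2
  exact ⟨(a, b), ⟨ha, hb⟩, ⟨ha', hb'⟩⟩

/-- Arbitrary products of directed sets, with the coordinatewise order, are directed. -/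
instance Pi.instIsDirectedOrderOfFactors {ι : Type*} (P : ι → Type*) [∀ i, PartialOrder (P i)]
    [∀ i, IsDirectedOrder (P i)] : IsDirectedOrder (∀ i, P i) := by
  refine ⟨fun x y => ?_⟩
  choose z hz hz' using fun i => exists_ge_ge (x i) (y i)
  exact ⟨z, hz, hz'⟩

/-- A directed set has calibre `(ω₁, ω)` if each of its uncountable subsets contains an infinite
subset that has an upper bound. -/
def HasCalibreOmega1Omega (P : Type*) [PartialOrder P] [IsDirectedOrder P] [Nonempty P] : Prop :=
  ∀ S : Set P, ¬ S.Countable → ∃ T : Set P, T ⊆ S ∧ T.Infinite ∧ BddAbove T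

/-- `P` is powerfully calibre `(ω₁, ω)` if its countable power `P^ω` has calibre `(ω₁, ω)`. -/
def IsPowerfullyCalibre (P : Type*) [PartialOrder P] [IsDirectedOrder P] [Nonempty P] : Prop :=
  HasCalibreOmega1Omega (ℕ → P)

/-- `P` is productively calibre `(ω₁, ω)` if `P × Q` has calibre `(ω₁, ω)` for every directed
set `Q` with calibre `(ω₁, ω)`. -/
def IsProductivelyCalibre.{u} (P : Type u) [PartialOrder P] [IsDirectedOrder P] [Nonempty P] :
    Prop :=
  ∀ (Q : Type u) [PartialOrder Q] [IsDirectedOrder Q] [Nonempty Q],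
    HasCalibreOmega1Omega Q → HasCalibreOmega1Omega (P × Q)

/-! ### Σ-products -/

/-- The Σ-product of a family of partially ordered sets with minimum elements: the elements of the
full product with countable support, with the (restricted) product order. -/
abbrev SigmaProduct {ι : Type*} (P : ι → Type*) [∀ i, PartialOrder (P i)]
    [∀ i, OrderBot (P i)] : Type _ :=
  {p : ∀ i, P i // {i | p i ≠ ⊥}.Countable}

instance SigmaProduct.instNonempty {ι : Type*} (P : ι → Type*) [∀ i, PartialOrder (P i)]
    [∀ i, OrderBot (P i)] : Nonempty (SigmaProduct P) :=
  ⟨⟨fun _ => ⊥, by simp⟩⟩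

instance SigmaProduct.instIsDirectedOrder {ι : Type*} (P : ι → Type*) [∀ i, PartialOrder (P i)]
    [∀ i, OrderBot (P i)] [∀ i, IsDirectedOrder (P i)] : IsDirectedOrder (SigmaProduct P) := by
  classical
  refine ⟨fun x y => ?_⟩
  have h : ∀ i, ∃ c, x.1 i ≤ c ∧ y.1 i ≤ c ∧ (x.1 i = ⊥ → y.1 i = ⊥ → c = ⊥) := by
    intro i
    by_cases hb : x.1 i = ⊥ ∧ y.1 i = ⊥
    · exact ⟨⊥, hb.1.le, hb.2.le, fun _ _ => rfl⟩
    · obtain ⟨c, hc, hc'⟩ := exists_ge_ge (x.1 i) (y.1 i)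
      exact ⟨c, hc, hc', fun h₁ h₂ => absurd ⟨h₁, h₂⟩ hb⟩
  choose z hz hz' hz0 using h
  refine ⟨⟨z, (x.2.union y.2).mono ?_⟩, hz, hz'⟩
  intro i hi
  by_contra hn
  simp only [Set.mem_union, Set.mem_ofPred_eq, not_or, not_not] at hn
  exact hi (hz0 i hn.1 hn.2)

/-- The well-ordered set `ω₁` of all countable ordinals, as a type. -/
abbrev Omega1 : Type := (ω_ 1 : Ordinal.{0}).ToType

/-- `ΣP^{ω₁}`, the Σ-product of `ω₁` many copies of `P`. -/
abbrev SigmaPower (P : Type) [PartialOrder P] [OrderBot P] : Type :=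
  SigmaProduct (fun _ : Omega1 => P)

/-! ### Refined totally imperfect sets of reals -/

/-- A set of reals is totally imperfect if it contains no nonempty perfect subset of `ℝ`. -/
def IsTotallyImperfect (A : Set ℝ) : Prop :=
  ∀ C : Set ℝ, C ⊆ A → Perfect C → C = ∅

/-- The set `A = {x_α : α < ω₁}` of reals, indexed bijectively by `x`, as the carrier of the
refined topology. -/
def RefinedReals (A : Set ℝ) (_x : Omega1 ≃ A) : Type := A

/-- The coarsest topology on `A` that contains the topology inherited from `ℝ` and in which all
the sets `U_α = {x_β : β ≥ α}`, `α < ω₁`, are open. -/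
instance RefinedReals.instTopologicalSpace (A : Set ℝ) (x : Omega1 ≃ A) :
    TopologicalSpace (RefinedReals A x) :=
  (instTopologicalSpaceSubtype : TopologicalSpace A) ⊓
    TopologicalSpace.generateFrom {U : Set A | ∃ α : Omega1, U = x '' Set.Ici α}

/-- `𝒦(X)`: all compact subsets (including `∅`) of the refined space `X`, ordered by inclusion. -/
abbrev KRefined (A : Set ℝ) (x : Omega1 ≃ A) : Type :=
  TopologicalSpace.Compacts (RefinedReals A x)

/-! Bounds come from convergence. In a Σ-product of copies of `ω`, an uncountable family has a
countable subfamily, closed under realizing finite patterns, from which distinct members can be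
chosen that converge pointwise to a member outside it. Convergent sequences of natural numbers are
bounded, and all the supports lie in one countable set.

For `P^ω`, an uncountable family of sequences of compact sets has a member `K` each of whose
neighbourhoods contains uncountably many members (`exists_condensation_point`). This rests on finite
products of well-orders being well-quasi-ordered. By the perfect set theorem compact subsets of `X`
are countable, so they have countable neighbourhood bases (`exists_seq_nhds`). Distinct members can
then converge to `K`, and in each coordinate they have compact union with `K`.

For the product with `Σω^{ω₁}`, attach to `x_α` the reciprocals of its distances to all earlier
points. A compact set with infinitely many `x_α` has an accumulation point `x_γ`, approached only
from indices above `γ`, so coordinate `γ` is unbounded. Since `A` is not compact, `X` has a sequence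
meeting each compact set finitely often. It codes `ω` in `P` and transfers both kinds of result
between powers of `ω` and of `P`. -/

/-! ### Calibre and Tukey reductions -/

/-- Calibre `(ω₁, ω)` passes down along maps that pull bounded sets back to bounded sets. -/
theorem HasCalibreOmega1Omega.of_tukey {P Q : Type*} [PartialOrder P] [IsDirectedOrder P]
    [Nonempty P] [PartialOrder Q] [IsDirectedOrder Q] [Nonempty Q]
    (hQ : HasCalibreOmega1Omega Q) (φ : P → Q)
    (hφ : ∀ T : Set P, BddAbove (φ '' T) → BddAbove T) : HasCalibreOmega1Omega P := by
  intro S hS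
  -- If the image is countable, some fibre of `φ` is uncountable, and it is bounded because its
  -- image is a single point.
  by_cases hc : (φ '' S).Countable
  · obtain ⟨q, hq⟩ : ∃ q, ¬ (S ∩ φ ⁻¹' {q}).Countable := by
      by_contra! h
      refine hS ((hc.biUnion fun q _ => h q).mono fun p hp => ?_)
      exact Set.mem_biUnion (Set.mem_image_of_mem φ hp) ⟨hp, rfl⟩
    refine ⟨S ∩ φ ⁻¹' {q}, Set.inter_subset_left, fun h => hq h.countable, hφ _ ⟨q, ?_⟩⟩
    rintro _ ⟨p, hp, rfl⟩
    exact le_of_eq hp.2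
  · obtain ⟨T, hTS, hT, hb⟩ := hQ _ hc
    refine ⟨S ∩ φ ⁻¹' T, Set.inter_subset_left, fun h => ?_, hφ _ (hb.mono ?_)⟩
    · refine hT ((h.image φ).subset fun q hq => ?_)
      obtain ⟨p, hp, rfl⟩ := hTS hq
      exact ⟨p, ⟨hp, hq⟩, rfl⟩
    · rintro _ ⟨p, hp, rfl⟩
      exact hp.2

/-- From a decreasing sequence of infinite sets one can choose distinct points. -/
theorem exists_injective_seq_of_antitone_infinite {α : Type*} {A : ℕ → Set α} (hA : Antitone A)
    (hinf : ∀ n, (A n).Infinite) : ∃ f : ℕ → α, Function.Injective f ∧ ∀ n, f n ∈ A n := by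
  classical
  obtain ⟨f, hf, hr⟩ := exists_seq_of_forall_finset_exists
    (fun p : ℕ × α => p.2 ∈ A p.1) (fun p q => p.1 < q.1 ∧ p.2 ≠ q.2) (by
      intro s _
      obtain ⟨a, ha, has⟩ := (hinf (s.sup Prod.fst + 1)).exists_notMem_finset (s.image Prod.snd)
      refine ⟨(s.sup Prod.fst + 1, a), ha, fun p hp => ⟨?_, ?_⟩⟩
      · exact Nat.lt_succ_of_le (Finset.le_sup (f := Prod.fst) hp)
      · rintro rfl
        exact has (Finset.mem_image_of_mem _ hp))
  have hmono : StrictMono fun n => (f n).1 := fun m n h => (hr m n h).1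
  refine ⟨fun n => (f n).2, fun m n h => ?_, fun n => hA (hmono.le_apply) (hf n)⟩
  by_contra hne
  rcases lt_or_gt_of_ne hne with h' | h'
  · exact (hr _ _ h').2 h
  · exact (hr _ _ h').2 h.symm

/-! ### Σ-products of copies of `ω` -/

/-- An uncountable family of functions with countable supports has a countable subfamily `M` that
realizes infinitely often every finite pattern, over the supports of members of `M`, which some
member outside `M` has. -/
theorem exists_countable_closed_subfamily {ι : Type*} (S : Set (ι → ℕ))
    (hsupp : ∀ f ∈ S, (Function.support f).Countable) :
    ∃ M ⊆ S, M.Countable ∧ ∀ f ∈ S, f ∉ M → ∀ F : Finset ι,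
      (↑F ⊆ ⋃ g ∈ M, Function.support g) → {g ∈ M | ∀ i ∈ F, g i = f i}.Infinite := by
  classical
  let A : Finset (ι × ℕ) → Set (ι → ℕ) := fun s => {f ∈ S | ∀ p ∈ s, f p.1 = p.2}
  have hc : ∀ s, ∃ C ⊆ A s, C.Countable ∧ (C.Infinite ∨ C = A s) := by
    intro s
    by_cases h : (A s).Infinite
    · obtain ⟨C, hC, hCi, hCc⟩ : ∃ C ⊆ A s, C.Infinite ∧ C.Countable :=
        ⟨Set.range fun n => (h.natEmbedding (A s) n : ι → ℕ),
          by rintro _ ⟨n, rfl⟩; exact (h.natEmbedding (A s) n).2,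
          Set.infinite_range_of_injective
            (Subtype.val_injective.comp (h.natEmbedding (A s)).injective),
          Set.countable_range _⟩
      exact ⟨C, hC, hCc, .inl hCi⟩
    · exact ⟨A s, subset_rfl, (Set.not_infinite.1 h).countable, .inr rfl⟩
  choose c hcA hcc hci using hc
  let D : Set (ι → ℕ) → Set ι := fun M => ⋃ g ∈ M, Function.support g
  -- Only patterns on the current supports are treated. There are countably many, so every stage
  -- stays countable.
  let step : Set (ι → ℕ) → Set (ι → ℕ) := fun M =>
    M ∪ ⋃ s ∈ {s : Finset (ι × ℕ) | (s : Set (ι × ℕ)) ⊆ D M ×ˢ Set.univ}, c s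
  let N : ℕ → Set (ι → ℕ) := fun n => step^[n] ∅
  have hN : ∀ n, N (n + 1) = step (N n) := fun n => Function.iterate_succ_apply' _ _ _
  have hNS : ∀ n, N n ⊆ S := by
    intro n
    induction n with
    | zero => exact Set.empty_subset _
    | succ n ih =>
      rw [hN]
      refine Set.union_subset ih (Set.iUnion₂_subset fun s _ => (hcA s).trans ?_)
      exact fun f hf => hf.1
  have hDc : ∀ M ⊆ S, M.Countable → (D M).Countable := fun M hM h =>
    h.biUnion fun g hg => hsupp g (hM hg)
  have hNc : ∀ n, (N n).Countable := by
    intro n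
    induction n with
    | zero => exact Set.countable_empty
    | succ n ih =>
      rw [hN]
      refine ih.union (Set.Countable.biUnion ?_ fun s _ => hcc s)
      refine ((Set.countable_ofPred_finite_subset ((hDc _ (hNS n) ih).prod
        Set.countable_univ)).preimage_of_injOn Finset.coe_injective.injOn).mono ?_
      exact fun s hs => ⟨s.finite_toSet, hs⟩
  have hNm : Monotone N := monotone_nat_of_le_succ fun n => by
    rw [hN]; exact Set.subset_union_left
  refine ⟨⋃ n, N n, Set.iUnion_subset hNS, Set.countable_iUnion hNc, fun f hf hfM F hF => ?_⟩
  have hDm : Monotone fun n => D (N n) := fun m n h =>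
    Set.biUnion_subset_biUnion_left (hNm h)
  have hF' : (F : Set ι) ⊆ ⋃ n, D (N n) := by
    intro i hi
    obtain ⟨g, hg, hgi⟩ := Set.mem_iUnion₂.1 (hF hi)
    obtain ⟨n, hn⟩ := Set.mem_iUnion.1 hg
    exact Set.mem_iUnion.2 ⟨n, Set.mem_biUnion hn hgi⟩
  obtain ⟨n, hn⟩ := (hDm.directed_le).exists_mem_subset_of_finset_subset_biUnion hF'
  let s : Finset (ι × ℕ) := F.image fun i => (i, f i)
  have hs : c s ⊆ ⋃ n, N n := by
    refine Set.Subset.trans ?_ (Set.subset_iUnion N (n + 1))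
    rw [hN]
    refine Set.Subset.trans ?_ Set.subset_union_right
    refine Set.subset_biUnion_of_mem (u := c) (x := s) ?_
    intro p hp
    obtain ⟨i, hi, rfl⟩ := Finset.mem_image.1 (Finset.mem_coe.1 hp)
    exact ⟨hn hi, trivial⟩
  have hfA : f ∈ A s := ⟨hf, fun p hp => by
    obtain ⟨i, hi, rfl⟩ := Finset.mem_image.1 hp
    rfl⟩
  -- If `c s` were all of `A s`, it would put `f` into the subfamily; hence `c s` is infinite.
  refine ((hci s).resolve_right fun h => hfM (hs (h ▸ hfA))).mono fun g hg => ⟨hs hg, ?_⟩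
  exact fun i hi => (hcA s hg).2 (i, f i) (Finset.mem_image_of_mem _ hi)

/-- The Σ-product of any number of copies of `ω` has calibre `(ω₁, ω)`. -/
theorem hasCalibre_sigmaProduct_nat (ι : Type*) :
    HasCalibreOmega1Omega (SigmaProduct fun _ : ι => ℕ) := by
  classical
  intro S hS
  obtain ⟨M, hMS, hMc, hM⟩ := exists_countable_closed_subfamily (Subtype.val '' S) (by
    rintro _ ⟨f, -, rfl⟩
    exact f.2)
  obtain ⟨f, hf, hfM⟩ : ∃ f ∈ Subtype.val '' S, f ∉ M := by
    by_contra! h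
    exact hS (Set.countable_of_injective_of_countable_image Subtype.val_injective.injOn
      (hMc.mono h))
  set D := ⋃ g ∈ M, Function.support g with hD
  have hDc : D.Countable := hMc.biUnion fun g hg => by
    obtain ⟨p, -, rfl⟩ := hMS hg
    exact p.2
  obtain ⟨e, he⟩ := Set.countable_iff_exists_injOn.1 hDc
  have hfin : ∀ n, {i ∈ D | e i < n}.Finite := fun n =>
    Set.Finite.of_finite_image ((Set.finite_lt_nat n).subset (by
      rintro _ ⟨i, hi, rfl⟩; exact hi.2)) (he.mono fun i hi => hi.1)
  obtain ⟨h, hinj, hh⟩ := exists_injective_seq_of_antitone_infinite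
    (A := fun n => {g ∈ M | ∀ i ∈ D, e i < n → g i = f i})
    (fun m n hmn g hg => ⟨hg.1, fun i hi hin => hg.2 i hi (hin.trans_le hmn)⟩)
    (fun n => (hM f hf hfM (hfin n).toFinset (by
      intro i hi; simp only [Set.Finite.coe_toFinset] at hi; exact hi.1)).mono fun g hg =>
        ⟨hg.1, fun i hi hin => hg.2 i ((hfin n).mem_toFinset.2 ⟨hi, hin⟩)⟩)
  -- At `i ∈ D` every `h n` with `n > e i` takes the value `f i`; the sum dominates the remaining
  -- terms.
  let b : ι → ℕ := fun i => if i ∈ D then f i + ∑ n ∈ Finset.range (e i + 1), h n i else 0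
  have hb : {i | b i ≠ ⊥}.Countable := hDc.mono fun i hi => by
    by_contra hn
    exact hi (if_neg hn)
  refine ⟨S ∩ Subtype.val ⁻¹' Set.range h, Set.inter_subset_left, fun hT => ?_, ⟨b, hb⟩, ?_⟩
  · refine Set.infinite_range_of_injective hinj ((hT.image Subtype.val).subset ?_)
    rintro _ ⟨n, rfl⟩
    obtain ⟨p, hp, hpn⟩ := hMS (hh n).1
    exact ⟨p, ⟨hp, n, hpn.symm⟩, hpn⟩
  · rintro p ⟨-, n, hn⟩ i
    change p.1 i ≤ b i
    rw [← hn]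
    by_cases hi : i ∈ D
    · simp only [b, if_pos hi]
      by_cases hin : e i < n
      · rw [(hh n).2 i hi hin]
        exact Nat.le_add_right _ _
      · refine le_trans ?_ (Nat.le_add_left _ _)
        exact Finset.single_le_sum (f := fun n => h n i) (fun _ _ => Nat.zero_le _)
          (Finset.mem_range.2 (by omega))
    · have : h n i = 0 := by
        by_contra h0
        exact hi (Set.mem_biUnion (hh n).1 h0)
      rw [this]
      exact Nat.zero_le _

/-- Countable powers of `Σω^{ω₁}` have calibre `(ω₁, ω)`. -/
theorem hasCalibre_pow_sigmaPower_nat : HasCalibreOmega1Omega (ℕ → SigmaPower ℕ) := by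
  refine (hasCalibre_sigmaProduct_nat (ℕ × Omega1)).of_tukey
    (fun p => ⟨fun q => (p q.1).1 q.2, ?_⟩) ?_
  · refine (Set.countable_iUnion fun n => ((p n).2.image (Prod.mk n))).mono ?_
    rintro ⟨n, i⟩ h
    exact Set.mem_iUnion.2 ⟨n, i, h, rfl⟩
  · rintro T ⟨b, hb⟩
    refine ⟨fun n => ⟨fun i => b.1 (n, i), (b.2.preimage (Prod.mk_right_injective n))⟩, ?_⟩
    intro p hp n i
    exact hb (Set.mem_image_of_mem _ hp) (n, i)

theorem hasCalibre_sigmaPower_nat : HasCalibreOmega1Omega (SigmaPower ℕ) := by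
  refine hasCalibre_pow_sigmaPower_nat.of_tukey (fun p _ => p) ?_
  rintro T ⟨b, hb⟩
  exact ⟨b 0, fun p hp => hb (Set.mem_image_of_mem _ hp) 0⟩

theorem hasCalibre_pi_nat (J : Type*) [Countable J] : HasCalibreOmega1Omega (J → ℕ) := by
  refine (hasCalibre_sigmaProduct_nat J).of_tukey (fun f => ⟨f, Set.to_countable _⟩) ?_
  rintro T ⟨b, hb⟩
  exact ⟨b.1, fun f hf => hb (Set.mem_image_of_mem _ hf)⟩

/-- If compact sets `L n` are eventually in each neighbourhood of the compact set `K`, then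
`K ∪ ⋃ n, L n` is compact. -/
theorem IsCompact.union_iUnion_of_eventually_subset {Y : Type*} [TopologicalSpace Y] {K : Set Y}
    (hK : IsCompact K) {L : ℕ → Set Y} (hL : ∀ n, IsCompact (L n))
    (h : ∀ U, IsOpen U → K ⊆ U → ∃ n₀, ∀ n ≥ n₀, L n ⊆ U) : IsCompact (K ∪ ⋃ n, L n) := by
  classical
  refine isCompact_of_finite_subcover fun {ι} U hU hcov => ?_
  obtain ⟨t, ht⟩ := hK.elim_finite_subcover U hU (Set.subset_union_left.trans hcov)
  obtain ⟨n₀, hn₀⟩ := h _ (isOpen_biUnion fun i _ => hU i) ht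
  obtain ⟨t', ht'⟩ := ((Finset.range n₀).isCompact_biUnion fun n _ => hL n).elim_finite_subcover
    U hU ((Set.iUnion₂_subset fun n _ => Set.subset_iUnion L n).trans
      (Set.subset_union_right.trans hcov))
  refine ⟨t ∪ t', ?_⟩
  rw [Finset.set_biUnion_union]
  refine Set.union_subset (ht.trans Set.subset_union_left) (Set.iUnion_subset fun n => ?_)
  rcases lt_or_ge n n₀ with hn | hn
  · exact (Set.subset_biUnion_of_mem (u := L) (Finset.mem_range.2 hn)).trans
      (ht'.trans Set.subset_union_right)
  · exact (hn₀ n hn).trans Set.subset_union_left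

/-! ### Spaces with a countable base refined by a well-ordering -/

/-- The sets `B ∩ {z | γ ≤ ρ z}`, where `B` runs through the countable family `𝓑`, are open and
those with `γ = ρ y` contain a base at `y`. -/
structure IsWellOrderedBase {Y W : Type*} [TopologicalSpace Y] [LinearOrder W]
    (𝓑 : Set (Set Y)) (ρ : Y → W) : Prop where
  countable : 𝓑.Countable
  isOpen : ∀ B ∈ 𝓑, ∀ γ, IsOpen (B ∩ {z | γ ≤ ρ z})
  exists_subset : ∀ V, IsOpen V → ∀ y ∈ V, ∃ B ∈ 𝓑, y ∈ B ∧ B ∩ {z | ρ y ≤ ρ z} ⊆ V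

namespace IsWellOrderedBase

variable {Y W : Type*} [TopologicalSpace Y] [LinearOrder W] {𝓑 : Set (Set Y)} {ρ : Y → W}

/-- For each `B` the least threshold that works for `V` gives the largest trace. A cover is thus
coded by a finite subset of the countable `𝓑` and one threshold per member. -/
theorem exists_finset_cover [WellFoundedLT W] [Nonempty W] (h : IsWellOrderedBase 𝓑 ρ)
    {K V : Set Y} (hK : IsCompact K) (hV : IsOpen V) (hKV : K ⊆ V) :
    ∃ (t : Finset 𝓑) (g : 𝓑 → W), (∀ y ∈ K, ∃ B ∈ t, y ∈ (B : Set Y) ∧ g B ≤ ρ y) ∧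
      ∀ B ∈ t, (B : Set Y) ∩ {z | g B ≤ ρ z} ⊆ V := by
  have hg : ∀ B : 𝓑, ∃ γ₀ : W, (∃ γ, (B : Set Y) ∩ {z | γ ≤ ρ z} ⊆ V) →
      (B : Set Y) ∩ {z | γ₀ ≤ ρ z} ⊆ V ∧ ∀ γ, (B : Set Y) ∩ {z | γ ≤ ρ z} ⊆ V → γ₀ ≤ γ := by
    intro B
    by_cases hB : ∃ γ, (B : Set Y) ∩ {z | γ ≤ ρ z} ⊆ V
    · have hne : {γ | (B : Set Y) ∩ {z | γ ≤ ρ z} ⊆ V}.Nonempty := hB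
      exact ⟨wellFounded_lt.min _ hne, fun _ => ⟨wellFounded_lt.min_mem _ hne,
        fun γ hγ => not_lt.1 (wellFounded_lt.not_lt_min _ hγ)⟩⟩
    · exact ⟨Classical.arbitrary W, fun h' => absurd h' hB⟩
  choose g hg using hg
  obtain ⟨t, htb, ht, hKt⟩ := hK.elim_finite_subcover_image
    (b := {B : 𝓑 | ∃ γ, (B : Set Y) ∩ {z | γ ≤ ρ z} ⊆ V})
    (c := fun B => (B : Set Y) ∩ {z | g B ≤ ρ z}) (fun B _ => h.isOpen _ B.2 _) (by
      intro y hy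
      obtain ⟨B, hB, hyB, hBV⟩ := h.exists_subset V hV y (hKV hy)
      exact Set.mem_biUnion (x := (⟨B, hB⟩ : 𝓑)) ⟨_, hBV⟩ ⟨hyB, (hg ⟨B, hB⟩ ⟨_, hBV⟩).2 _ hBV⟩)
  refine ⟨ht.toFinset, g, fun y hy => ?_, fun B hB => (hg B (htb (ht.mem_toFinset.1 hB))).1⟩
  obtain ⟨B, hB, hyB⟩ := Set.mem_iUnion₂.1 (hKt hy)
  exact ⟨B, ht.mem_toFinset.2 hB, hyB⟩

/-- Basic sets centred at points of `K` use thresholds in the countable set `ρ '' K`, so they have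
only countably many finite unions. -/
theorem exists_seq_nhds (h : IsWellOrderedBase 𝓑 ρ) {K : Set Y} (hK : IsCompact K)
    (hKc : K.Countable) :
    ∃ V : ℕ → Set Y, Antitone V ∧ (∀ n, IsOpen (V n)) ∧ (∀ n, K ⊆ V n) ∧
      ∀ U, IsOpen U → K ⊆ U → ∃ n, V n ⊆ U := by
  classical
  let u : Set (𝓑 × W) → Set Y := fun F => ⋃ p ∈ F, ((p.1 : Set Y) ∩ {z | p.2 ≤ ρ z})
  have hu : ∀ F, IsOpen (u F) := fun F => isOpen_biUnion fun p _ => h.isOpen _ p.1.2 _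
  have : Countable 𝓑 := h.countable.to_subtype
  let E : Set (𝓑 × W) := Set.univ ×ˢ (ρ '' K)
  have hE : E.Countable := Set.countable_univ.prod (hKc.image ρ)
  let 𝒰 : Set (Set Y) := {U | U = Set.univ ∨ ∃ F, (F.Finite ∧ F ⊆ E) ∧ K ⊆ u F ∧ U = u F}
  have h𝒰 : 𝒰.Countable := by
    refine (((Set.countable_ofPred_finite_subset hE).image u).insert Set.univ).mono ?_
    rintro U (rfl | ⟨F, hF, -, rfl⟩)
    · exact Set.mem_insert _ _
    · exact Set.mem_insert_of_mem _ ⟨F, hF, rfl⟩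
  obtain ⟨v, hv⟩ := h𝒰.exists_eq_range ⟨Set.univ, .inl rfl⟩
  have hv𝒰 : ∀ n, IsOpen (v n) ∧ K ⊆ v n := fun n => by
    have : v n ∈ 𝒰 := hv ▸ Set.mem_range_self n
    rcases this with h' | ⟨F, -, hK', h'⟩
    · rw [h']; exact ⟨isOpen_univ, Set.subset_univ _⟩
    · rw [h']; exact ⟨hu F, hK'⟩
  refine ⟨fun n => ⋂ i ∈ Finset.range (n + 1), v i, fun m n hmn => ?_,
    fun n => isOpen_biInter_finset fun i _ => (hv𝒰 i).1,
    fun n => Set.subset_iInter₂ fun i _ => (hv𝒰 i).2, fun U hU hKU => ?_⟩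
  · exact Set.biInter_subset_biInter_left fun i hi =>
      Finset.mem_range.2 ((Finset.mem_range.1 hi).trans_le (by omega))
  · choose! B hB hyB hBU using fun y hy => h.exists_subset U hU y (hKU hy)
    obtain ⟨t, htK, hKt⟩ := hK.elim_nhds_subcover (fun y => B y ∩ {z | ρ y ≤ ρ z})
      (fun y hy => (h.isOpen _ (hB y hy) _).mem_nhds ⟨hyB y hy, le_rfl⟩)
    let F : Set (𝓑 × W) := {p | ∃ y ∈ t, (p.1 : Set Y) = B y ∧ p.2 = ρ y}
    have hF : F.Finite := by
      refine Set.Finite.of_finite_image ((t.finite_toSet.image fun y => (B y, ρ y)).subset ?_)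
        (f := fun p : 𝓑 × W => ((p.1 : Set Y), p.2)) ?_
      · rintro _ ⟨p, ⟨y, hy, h₁, h₂⟩, rfl⟩
        exact ⟨y, hy, Prod.ext h₁.symm h₂.symm⟩
      · intro p _ q _ hpq
        have h' := Prod.mk.inj hpq
        exact Prod.ext (Subtype.ext h'.1) h'.2
    have hFE : F ⊆ E := by
      rintro p ⟨y, hy, -, h₂⟩
      exact ⟨trivial, y, htK y hy, h₂.symm⟩
    have hKF : K ⊆ u F := fun z hz => by
      obtain ⟨y, hy, hzy⟩ := Set.mem_iUnion₂.1 (hKt hz)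
      exact Set.mem_biUnion (x := ((⟨B y, hB y (htK y hy)⟩, ρ y) : 𝓑 × W)) ⟨y, hy, rfl, rfl⟩ hzy
    obtain ⟨n, hn⟩ : u F ∈ Set.range v := hv ▸ Or.inr ⟨F, ⟨hF, hFE⟩, hKF, rfl⟩
    refine ⟨n, (Set.biInter_subset_of_mem (Finset.self_mem_range_succ n)).trans ?_⟩
    rw [hn]
    refine Set.iUnion₂_subset ?_
    rintro p ⟨y, hy, h₁, h₂⟩
    rw [h₁, h₂]
    exact hBU y (htK y hy)

/-- Every uncountable set of sequences of compact sets has a member all of whose neighbourhoods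
contain uncountably many members. -/
theorem exists_condensation_point [WellFoundedLT W] [Nonempty W] (h : IsWellOrderedBase 𝓑 ρ)
    {S : Set (ℕ → TopologicalSpace.Compacts Y)} (hS : ¬ S.Countable) :
    ∃ K ∈ S, ∀ (m : ℕ) (V : ℕ → Set Y), (∀ j < m, IsOpen (V j) ∧ (K j : Set Y) ⊆ V j) →
      ¬ {L ∈ S | ∀ j < m, (L j : Set Y) ⊆ V j}.Countable := by
  classical
  by_contra! hcon
  have : Countable 𝓑 := h.countable.to_subtype
  -- There are countably many templates `(m, τ)`; raising the thresholds `g` shrinks the set.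
  let N : (m : ℕ) → (τ : Finset (ℕ × 𝓑)) → (τ → W) → Set (ℕ → TopologicalSpace.Compacts Y) :=
    fun m τ g => {L | ∀ j < m, ∀ y ∈ L j, ∃ p : τ, p.1.1 = j ∧ y ∈ (p.1.2 : Set Y) ∧ g p ≤ ρ y}
  have hN : ∀ (m : ℕ) (τ : Finset (ℕ × 𝓑)) (g g' : τ → W), g ≤ g' → N m τ g' ⊆ N m τ g := by
    intro m τ g g' hg L hL j hj y hy
    obtain ⟨p, hp, hyp, hgp⟩ := hL j hj y hy
    exact ⟨p, hp, hyp, (hg p).trans hgp⟩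
  let G : (m : ℕ) → (τ : Finset (ℕ × 𝓑)) → Set (τ → W) :=
    fun m τ => {g | {L ∈ S | L ∈ N m τ g}.Countable}
  have hG : ∀ K ∈ S, ∃ m τ, ∃ g ∈ G m τ, K ∈ N m τ g := by
    intro K hKS
    obtain ⟨m, V, hV, hc⟩ := hcon K hKS
    have hcov : ∀ j, ∃ (t : Finset 𝓑) (g : 𝓑 → W), j < m →
        (∀ y ∈ K j, ∃ B ∈ t, y ∈ (B : Set Y) ∧ g B ≤ ρ y) ∧
          ∀ B ∈ t, (B : Set Y) ∩ {z | g B ≤ ρ z} ⊆ V j := by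
      intro j
      by_cases hj : j < m
      · obtain ⟨t, g, htg⟩ := h.exists_finset_cover (K j).isCompact (hV j hj).1 (hV j hj).2
        exact ⟨t, g, fun _ => htg⟩
      · exact ⟨∅, fun _ => Classical.arbitrary W, fun h' => absurd h' hj⟩
    choose t g htg using hcov
    refine ⟨m, (Finset.range m).biUnion fun j => (t j).image (Prod.mk j),
      fun p => g p.1.1 p.1.2, hc.mono ?_, ?_⟩
    · rintro L ⟨hLS, hL⟩
      refine ⟨hLS, fun j hj y hy => ?_⟩
      obtain ⟨⟨⟨j', B⟩, hp⟩, rfl, hyB, hgB⟩ := hL j hj y hy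
      simp only [Finset.mem_biUnion, Finset.mem_image, Prod.mk.injEq] at hp
      obtain ⟨i, -, B', hB', rfl, rfl⟩ := hp
      exact (htg i hj).2 B' hB' ⟨hyB, hgB⟩
    · intro j hj y hy
      obtain ⟨B, hB, hyB, hgB⟩ := (htg j hj).1 y hy
      exact ⟨⟨(j, B), Finset.mem_biUnion.2 ⟨j, Finset.mem_range.2 hj,
        Finset.mem_image_of_mem _ hB⟩⟩, rfl, hyB, hgB⟩
  -- Minimal elements of `G m τ` form an antichain in a well-quasi-order, so they are finite in
  -- number. Every `g ∈ G m τ` lies above one of them, so countably many countable sets cover `S`.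
  refine hS ((Set.countable_iUnion fun m => Set.countable_iUnion fun τ =>
    ((WellQuasiOrderedLE.finite_of_isAntichain
      (setOfPred_minimal_antichain (· ∈ G m τ))).countable.biUnion
        (t := fun g _ => {L ∈ S | L ∈ N m τ g}) fun g hg => hg.prop)).mono fun K hK => ?_)
  obtain ⟨m, τ, g, hg, hKg⟩ := hG K hK
  obtain ⟨g₀, hle, hmin⟩ := exists_minimal_le_of_wellFoundedLT (· ∈ G m τ) g hg
  exact Set.mem_iUnion₂.2 ⟨m, τ, Set.mem_biUnion hmin ⟨hK, hN m τ g₀ g hle hKg⟩⟩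

/-- If all compact subsets are countable, then the countable power of the directed set of compact
subsets has calibre `(ω₁, ω)`. -/
theorem hasCalibre_pow_compacts [WellFoundedLT W] [Nonempty W] (h : IsWellOrderedBase 𝓑 ρ)
    (hc : ∀ K : Set Y, IsCompact K → K.Countable) :
    HasCalibreOmega1Omega (ℕ → TopologicalSpace.Compacts Y) := by
  intro S hS
  obtain ⟨K, -, hK⟩ := h.exists_condensation_point hS
  choose V hVa hVo hKV hV using fun j => h.exists_seq_nhds (K j).isCompact (hc _ (K j).isCompact)
  obtain ⟨L, hinj, hL⟩ := exists_injective_seq_of_antitone_infinite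
    (A := fun n => {L ∈ S | ∀ j < n, (L j : Set Y) ⊆ V j n})
    (fun m n hmn L hL => ⟨hL.1, fun j hj => (hL.2 j (hj.trans_le hmn)).trans (hVa j hmn)⟩)
    (fun n hfin => hK n (fun j => V j n) (fun j _ => ⟨hVo j n, hKV j n⟩) hfin.countable)
  refine ⟨Set.range L, ?_, Set.infinite_range_of_injective hinj,
    fun j => ⟨_, (K j).isCompact.union_iUnion_of_eventually_subset
      (fun n => (L n j).isCompact) fun U hU hKU => ?_⟩, ?_⟩
  · rintro _ ⟨n, rfl⟩
    exact (hL n).1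
  · obtain ⟨n, hn⟩ := hV j U hU hKU
    -- `L k` is controlled in coordinate `j` only when `j < k`.
    refine ⟨max n (j + 1), fun k hk => ?_⟩
    exact ((hL k).2 j (by omega)).trans ((hVa j (by omega)).trans hn)
  · rintro _ ⟨n, rfl⟩ j
    exact (Set.subset_iUnion (fun n => (L n j : Set Y)) n).trans Set.subset_union_right

end IsWellOrderedBase

/-! ### The ordinal `ω₁` -/

theorem Omega1.mk_eq : Cardinal.mk Omega1 = ℵ₁ := by simp

instance Omega1.instUncountable : Uncountable Omega1 := by
  rw [← Cardinal.aleph0_lt_mk_iff, Omega1.mk_eq]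
  exact Cardinal.aleph0_lt_aleph_one

theorem Omega1.countable_Iio (α : Omega1) : (Set.Iio α).Countable := by
  rw [← Cardinal.le_aleph0_iff_set_countable, ← Cardinal.lt_aleph_one_iff, ← Omega1.mk_eq]
  exact Cardinal.mk_Iio_lt α (by rw [Omega1.mk_eq, Cardinal.ord_aleph, Ordinal.type_toType])

/-! ### The refined topology -/

theorem IsTotallyImperfect.countable_of_isClosed {A C : Set ℝ} (hA : IsTotallyImperfect A)
    (hC : IsClosed C) (hCA : C ⊆ A) : C.Countable := by
  by_contra h
  obtain ⟨D, hD, hne, hDC⟩ := exists_perfect_nonempty_of_isClosed_of_not_countable hC h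
  exact hne.ne_empty (hA D (hDC.trans hCA) hD)

namespace RefinedReals

variable {A : Set ℝ} {x : Omega1 ≃ A}

/-- The inclusion of the refined space into the reals. -/
def val (y : RefinedReals A x) : ℝ := Subtype.val (p := (· ∈ A)) y

/-- The index `α` of the point `x_α`. -/
def index (y : RefinedReals A x) : Omega1 := x.symm y

/-- The point `x_α` of the refined space. -/
def point (x : Omega1 ≃ A) (α : Omega1) : RefinedReals A x := x α

@[simp] theorem index_point (α : Omega1) : (point x α).index = α := x.symm_apply_apply α

@[simp] theorem point_index (y : RefinedReals A x) : point x y.index = y := x.apply_symm_apply y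

theorem val_injective : Function.Injective (val : RefinedReals A x → ℝ) := Subtype.val_injective

theorem point_injective : Function.Injective (point x) := x.injective

theorem val_mem (y : RefinedReals A x) : y.val ∈ A := Subtype.property (p := (· ∈ A)) y

theorem continuous_val : Continuous (val : RefinedReals A x → ℝ) :=
  continuous_inf_dom_left (t₁ := (instTopologicalSpaceSubtype : TopologicalSpace A))
    (t₂ := TopologicalSpace.generateFrom {U : Set A | ∃ α : Omega1, U = x '' Set.Ici α})
    (f := (Subtype.val : A → ℝ)) continuous_subtype_val

theorem isOpen_of_isOpen_subtype {B : Set A} (hB : IsOpen B) :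
    @IsOpen (RefinedReals A x) _ B :=
  (inf_le_left : RefinedReals.instTopologicalSpace A x ≤ instTopologicalSpaceSubtype) B hB

theorem isOpen_le_index (γ : Omega1) : IsOpen {z : RefinedReals A x | γ ≤ z.index} := by
  refine (inf_le_right : RefinedReals.instTopologicalSpace A x ≤ TopologicalSpace.generateFrom
    {U : Set A | ∃ α : Omega1, U = x '' Set.Ici α}) _ (.basic _ ⟨γ, ?_⟩)
  exact (x.image_eq_preimage_symm (Set.Ici γ)).symm

/-- A generator containing `x_β` is a final segment starting at or below `β`, so it contains the one
starting at `β`. -/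
theorem principal_image_Ici_le_nhds (a : A) : Filter.principal (x '' Set.Ici (x.symm a)) ≤
    @nhds A (TopologicalSpace.generateFrom {U : Set A | ∃ α : Omega1, U = x '' Set.Ici α}) a := by
  rw [TopologicalSpace.nhds_generateFrom]
  refine le_iInf₂ ?_
  rintro s ⟨hs, α, rfl⟩
  obtain ⟨β, hβ, rfl⟩ := hs
  rw [x.symm_apply_apply]
  exact Filter.principal_mono.2 (Set.image_mono (Set.Ici_subset_Ici.2 hβ))

theorem exists_isOpen_inter_subset {V : Set (RefinedReals A x)} (hV : IsOpen V)
    {y : RefinedReals A x} (hy : y ∈ V) :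
    ∃ B : Set A, IsOpen B ∧ B y ∧ ∀ z : RefinedReals A x, B z → y.index ≤ z.index → z ∈ V := by
  have h := hV.mem_nhds hy
  rw [show nhds y = @nhds A instTopologicalSpaceSubtype y ⊓ @nhds A (TopologicalSpace.generateFrom
    {U : Set A | ∃ α : Omega1, U = x '' Set.Ici α}) y from
    nhds_inf (α := A)] at h
  obtain ⟨V₁, h₁, V₂, h₂, rfl⟩ := Filter.mem_inf_iff.1 h
  obtain ⟨B, hBV, hB, hyB⟩ := mem_nhds_iff.1 h₁
  refine ⟨B, hB, hyB, fun z hz hyz => ⟨hBV hz, ?_⟩⟩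
  exact principal_image_Ici_le_nhds y h₂ ⟨z.index, hyz, x.apply_symm_apply z⟩

theorem isWellOrderedBase : IsWellOrderedBase (Y := RefinedReals A x)
    (TopologicalSpace.countableBasis A : Set (Set (RefinedReals A x)))
    (index (x := x)) where
  countable := TopologicalSpace.countable_countableBasis A
  isOpen B hB γ := (isOpen_of_isOpen_subtype
    (TopologicalSpace.isOpen_of_mem_countableBasis hB)).inter (isOpen_le_index (x := x) γ)
  exists_subset V hV y hy := by
    obtain ⟨B, hB, hyB, hBV⟩ := exists_isOpen_inter_subset (x := x) hV hy
    obtain ⟨B', hB', hyB', hBB'⟩ :=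
      (TopologicalSpace.isBasis_countableBasis A).exists_subset_of_mem_open hyB hB
    exact ⟨B', hB', hyB', fun z hz => hBV z (hBB' hz.1) hz.2⟩

theorem countable_of_isCompact (hA : IsTotallyImperfect A) {K : Set (RefinedReals A x)}
    (hK : IsCompact K) : K.Countable :=
  Set.countable_of_injective_of_countable_image val_injective.injOn
    (hA.countable_of_isClosed (hK.image continuous_val).isClosed (by
      rintro _ ⟨y, -, rfl⟩
      exact y.val_mem))

/-- The refined space contains a sequence of which each compact set contains only finitely many
terms. -/
theorem exists_seq_finite_mem_compact (hA : IsTotallyImperfect A) :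
    ∃ p : ℕ → RefinedReals A x, ∀ K : KRefined A x, {n | p n ∈ K}.Finite := by
  -- `A` is uncountable, whereas a compact totally imperfect set is countable.
  have hAc : ¬ IsSeqCompact A := fun h => by
    have hc := hA.countable_of_isClosed h.isCompact.isClosed subset_rfl
    exact not_countable (α := Omega1) (x.countable_iff.2 hc.to_subtype)
  simp only [IsSeqCompact, not_forall, not_exists, not_and] at hAc
  obtain ⟨p, hp, hlim⟩ := hAc
  refine ⟨fun n => (⟨p n, hp n⟩ : A), fun K => Set.not_infinite.1 fun hK => ?_⟩
  obtain ⟨a, ⟨y, -, rfl⟩, φ, hφ, hφa⟩ := (K.isCompact.image continuous_val).tendsto_subseq'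
    (x := p) ((Nat.frequently_atTop_iff_infinite.2 hK).mono fun n hn => ⟨_, hn, rfl⟩)
  exact hlim _ y.val_mem φ hφ hφa

end RefinedReals

open RefinedReals

/-! ### Calibre of `𝒦(X)` and its products -/

theorem hasCalibre_pow_kRefined {A : Set ℝ} {x : Omega1 ≃ A} (hA : IsTotallyImperfect A)
    : HasCalibreOmega1Omega (ℕ → KRefined A x) :=
  (isWellOrderedBase (x := x)).hasCalibre_pow_compacts fun _ hK => countable_of_isCompact hA hK

theorem hasCalibre_kRefined {A : Set ℝ} {x : Omega1 ≃ A} (hA : IsTotallyImperfect A)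
    : HasCalibreOmega1Omega (KRefined A x) := by
  refine (hasCalibre_pow_kRefined hA).of_tukey (fun K _ => K) ?_
  rintro T ⟨b, hb⟩
  exact ⟨b 0, fun K hK => hb (Set.mem_image_of_mem _ hK) 0⟩

theorem hasCalibre_pi_kRefined {A : Set ℝ} {x : Omega1 ≃ A} (hA : IsTotallyImperfect A)
    (J : Type*) [Countable J] :
    HasCalibreOmega1Omega (J → KRefined A x) := by
  obtain ⟨e, he⟩ := exists_injective_nat J
  refine (hasCalibre_pow_kRefined hA).of_tukey (fun K => Function.extend e K ⊥) ?_
  rintro T ⟨b, hb⟩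
  refine ⟨fun j => b (e j), fun K hK j => ?_⟩
  rw [← he.extend_apply K ⊥ j]
  exact hb (Set.mem_image_of_mem _ hK) (e j)

/-- Replacing `n` by `{p n}` embeds the product in a countable power of `𝒦(X)`: a compact bound
contains finitely many `p n`, hence bounds `n`. -/
theorem hasCalibre_kRefined_prod {A : Set ℝ} {x : Omega1 ≃ A} (hA : IsTotallyImperfect A)
    (J : Type*) [Countable J] :
    HasCalibreOmega1Omega (KRefined A x × (J → ℕ)) := by
  obtain ⟨p, hp⟩ := exists_seq_finite_mem_compact (x := x) hA
  refine (hasCalibre_pi_kRefined hA (Option J)).of_tukey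
    (fun q => fun o => o.elim q.1 fun j => {p (q.2 j)}) ?_
  rintro T ⟨b, hb⟩
  choose c hc using fun j => (hp (b (some j))).bddAbove
  refine ⟨(b none, c), fun q hq => ⟨hb (Set.mem_image_of_mem _ hq) none, fun j => hc j ?_⟩⟩
  exact hb (Set.mem_image_of_mem _ hq) (some j) rfl

theorem not_hasCalibre_kRefined_prod_sigmaPower (A : Set ℝ) (x : Omega1 ≃ A) :
    ¬ HasCalibreOmega1Omega (KRefined A x × SigmaPower ℕ) := by
  classical
  intro hcal
  let f : Omega1 → SigmaPower ℕ := fun α =>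
    ⟨fun γ => if γ < α then ⌈|(point x α).val - (point x γ).val|⁻¹⌉₊ else 0, by
      refine (Omega1.countable_Iio α).mono fun γ hγ => ?_
      by_contra hn
      exact hγ (if_neg hn)⟩
  let q : Omega1 → KRefined A x × SigmaPower ℕ := fun α => ({point x α}, f α)
  have hq : Function.Injective q := fun α β h => by
    have h' : ({point x α} : KRefined A x) = {point x β} := congrArg Prod.fst h
    exact point_injective (TopologicalSpace.Compacts.singleton_injective h')
  obtain ⟨T, hTq, hT, ⟨K, b⟩, hb⟩ := hcal (Set.range q) fun h =>
    Set.not_countable_univ (α := Omega1) 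
      (Set.countable_of_injective_of_countable_image hq.injOn (Set.image_univ ▸ h))
  have hI : (q ⁻¹' T).Infinite := hT.preimage hTq
  have hmem : ∀ α ∈ q ⁻¹' T, point x α ∈ K := fun α hα => (hb hα).1 rfl
  obtain ⟨y, -, hy⟩ := (hI.image point_injective.injOn).exists_accPt_of_subset_isCompact
    K.isCompact (by rintro _ ⟨α, hα, rfl⟩; exact hmem α hα)
  set γ := y.index with hγ
  have hpos : (0 : ℝ) < (b.1 γ + 1 : ℝ)⁻¹ := by positivity
  -- The radius makes the reciprocal distance exceed `b.1 γ + 1`; the index condition forces `γ <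
  -- α`, where `f α` is not set to `0`.
  have hnhds : val ⁻¹' Metric.ball y.val (b.1 γ + 1 : ℝ)⁻¹ ∩ {z | y.index ≤ z.index} ∈ nhds y :=
    Filter.inter_mem (continuous_val.continuousAt.preimage_mem_nhds (Metric.ball_mem_nhds _ hpos))
      ((isOpen_le_index _).mem_nhds (le_refl y.index))
  obtain ⟨_, ⟨⟨hball, hle⟩, α, hα, rfl⟩, hne⟩ := accPt_iff_nhds.1 hy _ hnhds
  rw [Set.mem_ofPred_eq, index_point, ← hγ] at hle
  have hlt : γ < α := hle.lt_of_ne fun h => hne (by rw [← h, hγ, point_index])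
  have hfb : (f α).1 γ ≤ b.1 γ := (hb hα).2 γ
  have hval : (f α).1 γ = ⌈|(point x α).val - y.val|⁻¹⌉₊ := by
    simp only [f, if_pos hlt]
    rw [hγ, point_index]
  have hd : 0 < |(point x α).val - y.val| :=
    abs_pos.2 (sub_ne_zero.2 fun h => hne (val_injective h))
  have hball' : |(point x α).val - y.val| < (b.1 γ + 1 : ℝ)⁻¹ := hball
  have h₁ : (b.1 γ + 1 : ℝ) < |(point x α).val - y.val|⁻¹ := by
    rwa [lt_inv_comm₀ (by positivity) hd]
  have h₂ := (h₁.trans_le (Nat.le_ceil _)).trans_le (Nat.cast_le.2 (hval ▸ hfb))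
  linarith

theorem not_hasCalibre_sigmaPower_kRefined {A : Set ℝ} {x : Omega1 ≃ A}
    (hA : IsTotallyImperfect A) : ¬ HasCalibreOmega1Omega (SigmaPower (KRefined A x)) := by
  classical
  obtain ⟨p, hp⟩ := exists_seq_finite_mem_compact (x := x) hA
  intro hcal
  obtain ⟨γ₀⟩ : Nonempty Omega1 := inferInstance
  refine not_hasCalibre_kRefined_prod_sigmaPower A x (hcal.of_tukey
    -- Coordinate `γ₀` also carries the compact set; sending `0` to `⊥` keeps the support countable.
    (fun q => ⟨fun γ => (if γ = γ₀ then q.1 else ⊥) ⊔ if q.2.1 γ = 0 then ⊥ else {p (q.2.1 γ)},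
      (q.2.2.insert γ₀).mono fun γ hγ => ?_⟩) ?_)
  · by_contra hn
    rw [Set.mem_insert_iff, not_or] at hn
    have h0 : q.2.1 γ = 0 := not_not.1 hn.2
    exact hγ (by simp only [if_neg hn.1, if_pos h0, sup_idem])
  · rintro T ⟨b, hb⟩
    choose c hc using fun γ => (hp (b.1 γ)).bddAbove
    have hle : ∀ q ∈ T, ∀ γ, (if γ = γ₀ then q.1 else ⊥) ≤ b.1 γ ∧
        (if q.2.1 γ = 0 then ⊥ else {p (q.2.1 γ)}) ≤ b.1 γ := fun q hq γ =>
      sup_le_iff.1 (hb (Set.mem_image_of_mem _ hq) γ)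
    have hsupp : {γ | (if b.1 γ = ⊥ then 0 else c γ) ≠ ⊥}.Countable :=
      b.2.mono fun γ hγ h => hγ (if_pos h)
    refine ⟨(b.1 γ₀, ⟨_, hsupp⟩), fun q hq => ⟨?_, fun γ => ?_⟩⟩
    · simpa using (hle q hq γ₀).1
    · change q.2.1 γ ≤ if b.1 γ = ⊥ then 0 else c γ
      have h := (hle q hq γ).2
      by_cases h0 : q.2.1 γ = 0
      · rw [h0]; exact Nat.zero_le _
      · rw [if_neg h0] at h
        have hmem : p (q.2.1 γ) ∈ b.1 γ := h rfl
        rw [if_neg (fun hbot => by rw [hbot] at hmem; exact hmem)]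
        exact hc γ hmem

/-! ### Existence of totally imperfect sets of size `ω₁` -/

theorem Perfect.continuum_le_mk {C : Set ℝ} (hC : Perfect C) (hne : C.Nonempty) :
    𝔠 ≤ Cardinal.mk C := by
  obtain ⟨f, hf, -, hinj⟩ := hC.exists_nat_bool_injection hne
  have h : Cardinal.mk (ℕ → Bool) ≤ Cardinal.mk C :=
    Cardinal.mk_le_of_injective (f := fun b => (⟨f b, hf ⟨b, rfl⟩⟩ : C)) fun a b h =>
      hinj (congrArg Subtype.val h)
  simpa using h

/-- Perfect sets are Borel, and a countably generated σ-algebra has at most `𝔠` members. -/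
theorem mk_perfect_le_continuum :
    Cardinal.mk {C : Set ℝ | Perfect C ∧ C.Nonempty} ≤ 𝔠 := by
  refine le_trans (Cardinal.mk_le_mk_of_subset ?_)
    (MeasurableSpace.cardinal_measurableSet_le_continuum
      (s := TopologicalSpace.countableBasis ℝ)
      ((TopologicalSpace.countable_countableBasis ℝ).le_aleph0.trans Cardinal.aleph0_le_continuum))
  intro C hC
  have h := hC.1.closed.measurableSet
  rwa [BorelSpace.measurable_eq (α := ℝ),
    (TopologicalSpace.isBasis_countableBasis ℝ).borel_eq_generateFrom] at h

/-- Under the continuum hypothesis, a Bernstein set is built by recursion of length `ω₁`. -/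
theorem exists_totallyImperfect_of_continuum_eq (hCH : (𝔠 : Cardinal.{0}) = ℵ₁) :
    ∃ A : Set ℝ, Cardinal.mk A = ℵ₁ ∧ IsTotallyImperfect A := by
  have hle : Cardinal.mk {C : Set ℝ | Perfect C ∧ C.Nonempty} ≤ Cardinal.mk Omega1 := by
    rw [Omega1.mk_eq, ← hCH]
    exact mk_perfect_le_continuum
  obtain ⟨e⟩ := hle
  have hunc : ∀ C : Set ℝ, Perfect C → C.Nonempty → ¬ C.Countable := fun C hC hne h =>
    (Cardinal.aleph0_lt_continuum.trans_le (hC.continuum_le_mk hne)).not_ge h.le_aleph0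
  -- The first component enters `A`; the second is a point of the perfect set numbered `α`, if there
  -- is one, reserved to stay outside `A`.
  have step : ∀ (α : Omega1) (r : ∀ β, β < α → ℝ × ℝ), ∃ z : ℝ × ℝ,
      (∀ β h, z.1 ≠ (r β h).1 ∧ z.1 ≠ (r β h).2 ∧ z.2 ≠ (r β h).1) ∧ z.2 ≠ z.1 ∧
        ∀ C, e C = α → z.2 ∈ C.1 := by
    intro α r
    have hIio := (Omega1.countable_Iio α).to_subtype
    have hc : (Set.range fun β : Set.Iio α => (r β β.2).1).Countable := Set.countable_range _
    have hc' : (Set.range fun β : Set.Iio α => (r β β.2).2).Countable := Set.countable_range _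
    obtain ⟨a, ha⟩ : ∃ a, a ∉ (Set.range fun β : Set.Iio α => (r β β.2).1) ∪
        Set.range fun β : Set.Iio α => (r β β.2).2 := by
      by_contra! h
      exact Cardinal.not_countable_real ((hc.union hc').mono fun a _ => h a)
    obtain ⟨D, hD, hDe⟩ : ∃ D : Set ℝ, ¬ D.Countable ∧ ∀ C, e C = α → D = C.1 := by
      by_cases h : ∃ C, e C = α
      · obtain ⟨C, rfl⟩ := h
        exact ⟨C.1, hunc _ C.2.1 C.2.2, fun C' h' => by rw [e.injective h']⟩
      · exact ⟨Set.univ, Cardinal.not_countable_real, fun C hC => absurd ⟨C, hC⟩ h⟩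
    obtain ⟨b, hbD, hb⟩ : ∃ b ∈ D, b ∉ insert a (Set.range fun β : Set.Iio α => (r β β.2).1) := by
      by_contra! h
      exact hD ((hc.insert a).mono h)
    refine ⟨(a, b), fun β h => ⟨?_, ?_, ?_⟩, ?_, fun C hC => hDe C hC ▸ hbD⟩
    · exact fun h' => ha (.inl ⟨⟨β, h⟩, h'.symm⟩)
    · exact fun h' => ha (.inr ⟨⟨β, h⟩, h'.symm⟩)
    · exact fun h' => hb (.inr ⟨⟨β, h⟩, h'.symm⟩)
    · exact fun h' => hb (.inl h')
  choose F hF using step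
  let z : Omega1 → ℝ × ℝ := wellFounded_lt.fix F
  have hz : ∀ α, z α = F α fun β _ => z β := fun α => wellFounded_lt.fix_eq F α
  have hz₁ : ∀ α β, β < α → (z α).1 ≠ (z β).1 ∧ (z α).1 ≠ (z β).2 ∧ (z α).2 ≠ (z β).1 := by
    intro α β h
    rw [hz α]
    exact (hF α _).1 β h
  have hinj : Function.Injective fun α => (z α).1 := by
    intro α β h
    by_contra hne
    rcases lt_or_gt_of_ne hne with hlt | hlt
    · exact (hz₁ _ _ hlt).1 h.symm
    · exact (hz₁ _ _ hlt).1 h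
  refine ⟨Set.range fun α => (z α).1, ?_, fun C hCA hC => ?_⟩
  · rw [Cardinal.mk_range_eq _ hinj, Omega1.mk_eq]
  · by_contra hne
    let C' : {C : Set ℝ | Perfect C ∧ C.Nonempty} := ⟨C, hC, Set.nonempty_iff_ne_empty.2 hne⟩
    have hmem : (z (e C')).2 ∈ C := by
      rw [hz]
      exact (hF (e C') _).2.2 C' rfl
    obtain ⟨β, hβ⟩ := hCA hmem
    rcases lt_trichotomy β (e C') with h | h | h
    · exact (hz₁ _ _ h).2.2 hβ.symm
    · refine (hF (e C') fun β _ => z β).2.1 ?_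
      rw [← hz, ← hβ, h]
    · exact (hz₁ _ _ h).2.1 hβ

/-- If `ℵ₁ < 𝔠`, any set of size `ℵ₁` works, since nonempty perfect sets have size at least `𝔠`. -/
theorem exists_totallyImperfect : ∃ A : Set ℝ, Cardinal.mk A = ℵ₁ ∧ IsTotallyImperfect A := by
  rcases Cardinal.aleph_one_le_continuum.{0}.eq_or_lt with h | h
  · exact exists_totallyImperfect_of_continuum_eq h.symm
  · obtain ⟨A, hA⟩ := Cardinal.le_mk_iff_exists_set.1
      (Cardinal.aleph_one_le_continuum.trans_eq Cardinal.mk_real.symm)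
    refine ⟨A, hA, fun C hCA hC => ?_⟩
    by_contra hne
    exact h.not_ge ((hC.continuum_le_mk (Set.nonempty_iff_ne_empty.2 hne)).trans
      ((Cardinal.mk_le_mk_of_subset hCA).trans_eq hA))

theorem mainTheorem9 :
    -- there are totally imperfect sets of reals of size `ω₁`,
    (∃ A : Set ℝ, Cardinal.mk A = ℵ₁ ∧ IsTotallyImperfect A) ∧
    -- and for each of them, each indexing by `ω₁`, and `P = 𝒦(X)`:
    ∀ (A : Set ℝ) (x : Omega1 ≃ A), IsTotallyImperfect A →
      -- (i)
      (¬ HasCalibreOmega1Omega (KRefined A x × SigmaPower ℕ) ∧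
        ∀ J : Set Omega1, J.Countable →
          HasCalibreOmega1Omega (J → ℕ) ∧ HasCalibreOmega1Omega (KRefined A x × (J → ℕ))) ∧
      -- (ii)
      (¬ HasCalibreOmega1Omega (SigmaPower (KRefined A x)) ∧
        HasCalibreOmega1Omega (ℕ → KRefined A x) ∧
        ∀ J : Set Omega1, J.Countable → HasCalibreOmega1Omega (J → KRefined A x)) ∧
      -- hence
      (IsPowerfullyCalibre (KRefined A x) ∧ ¬ IsProductivelyCalibre (KRefined A x)) ∧
      (IsPowerfullyCalibre (SigmaPower ℕ) ∧ ¬ IsProductivelyCalibre (SigmaPower ℕ)) := by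
  refine ⟨exists_totallyImperfect, fun A x hA => ?_⟩
  have hprod := not_hasCalibre_kRefined_prod_sigmaPower A x
  refine ⟨⟨hprod, fun J hJ => ?_⟩,
    ⟨not_hasCalibre_sigmaPower_kRefined hA, hasCalibre_pow_kRefined hA, fun J hJ => ?_⟩,
    ⟨hasCalibre_pow_kRefined hA, fun h => hprod (h _ hasCalibre_sigmaPower_nat)⟩,
    hasCalibre_pow_sigmaPower_nat, fun h => hprod ?_⟩
  · have := hJ.to_subtype
    exact ⟨hasCalibre_pi_nat J, hasCalibre_kRefined_prod hA J⟩
  · have := hJ.to_subtype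
    exact hasCalibre_pi_kRefined hA J
  · refine (h _ (hasCalibre_kRefined hA)).of_tukey Prod.swap ?_
    rintro T ⟨b, hb⟩
    exact ⟨b.swap, fun q hq => ⟨(hb (Set.mem_image_of_mem _ hq)).2,
      (hb (Set.mem_image_of_mem _ hq)).1⟩⟩
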